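/- Let $d\ge 1$. A weight is a locally integrable, (almost everywhere) positive function $w$ on $\mathbb{R}^d$. For $1<p<\infty$ put $$[w]_{A_p}=\sup_Q\left(\frac1{|Q|}\int_Q w\right)\left(\frac1{|Q|}\int_Q w^{-1/(p-1)}\right)^{p-1},$$ where the supremum is taken over all cubes $Q\subset\mathbb{R}^d$ with sides parallel to the coordinate axes, and call $w$ an $A_p$ weight if $[w]_{A_p}<\infty$. Theorem 1.2. Suppose that $w$ is an $A_\beta$ weight on $\mathbb{R}^d$, where $1<\beta<\infty$, and put $$r=\frac{\beta\left(1+2^{\beta d/(\beta-1)}\beta^{\beta/(\beta-1)}[w]_{A_\beta}^{1/(\beta-1)}\right)}{\beta+2^{\beta d/(\beta-1)}\beta^{\beta/(\beta-1)}[w]_{A_\beta}^{1/(\beta-1)}}.$$ Then $r\in(1,\beta)$, $w$ is an $A_r$ weight, and $$[w]_{A_r}\le 2^{rd+r}\,[w]_{A_\beta}^{(r-1)/(\beta-1)}.$$ -/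

import Mathlib

open MeasureTheory
open scoped ENNReal

/-- The closed cube in `ℝ^d` with sides parallel to the axes, lower corner `a` and side length
`l`. -/
def cube {d : ℕ} (a : Fin d → ℝ) (l : ℝ) : Set (Fin d → ℝ) :=
  Set.Icc a (fun i => a i + l)

/-- The Muckenhoupt characteristic of `w` for the exponent `p > 1`, as an extended nonnegative
number: the supremum over all (nondegenerate) cubes `Q` of
`(avg_Q w) * (avg_Q w ^ (-1 / (p - 1))) ^ (p - 1)`. -/
noncomputable def eApChar {d : ℕ} (p : ℝ) (w : (Fin d → ℝ) → ℝ) : ℝ≥0∞ :=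
  ⨆ (a : Fin d → ℝ) (l : ℝ) (_ : 0 < l),
    (⨍⁻ x in cube a l, ENNReal.ofReal (w x) ∂volume) *
      (⨍⁻ x in cube a l, ENNReal.ofReal (w x ^ (-1 / (p - 1))) ∂volume) ^ (p - 1)

/-- The Muckenhoupt characteristic `[w]_{A_p}` as a real number. It is only used for `A_p`
weights, for which the supremum is finite. -/
noncomputable def apChar {d : ℕ} (p : ℝ) (w : (Fin d → ℝ) → ℝ) : ℝ :=
  (eApChar p w).toReal

/-- A weight on `ℝ^d`: a locally integrable function which is positive (almost everywhere). -/
structure IsWeight {d : ℕ} (w : (Fin d → ℝ) → ℝ) : Prop where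
  locallyIntegrable : LocallyIntegrable w volume
  pos : ∀ᵐ x ∂(volume : Measure (Fin d → ℝ)), 0 < w x

/-- The class `A_p`, for `1 < p < ∞`: weights with finite characteristic. -/
structure IsApWeight {d : ℕ} (p : ℝ) (w : (Fin d → ℝ) → ℝ) : Prop where
  isWeight : IsWeight w
  finite : eApChar p w < ∞

/-! Put `σ = w ^ (-1 / (β - 1))` and `α = 1 / (β - 1)`. The formula for `r` says that `(r - 1) * (1
+ δ) = β - 1` with `δ` of order `[w] ^ (-α)`, so `w ^ (-1 / (r - 1)) = σ ^ (1 + δ)`, and the `A_r`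
bound follows from the `A_β` bound once `σ` satisfies a reverse Hölder inequality with exponent `1 +
δ`.

That inequality (`treeMean_rpow_le`) is proved on the tree of dyadic subcubes of a cube, where each
cube has `N = 2 ^ d` children. Let `s` be the averages of `σ`, `M` their running maximum and `E` the
mean over descendants of a fixed generation. Doob's inequality for the averages of `w` gives `E M ≤
B * s` with `B = [w] ^ α * β ^ α` (`treeMean_max_le_mul`). Applied where `M` jumps, this gives `E M
^ (1 + δ) ≤ B * E (s * M ^ δ)` (`treeMean_max_rpow_le`). As a jump is at most by a factor `N`, `E (s
* M ^ δ)` is in turn controlled by `s ^ (1 + δ)` and `E M ^ (1 + δ)` (`treeMean_mul_max_rpow_le`).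
For `δ * N * B ≤ 1` the two combine to bound `E (s * M ^ δ)`, hence `E s ^ (1 + δ)`.

Lebesgue differentiation and Fatou's lemma transfer the bound from averages to `σ`. The constants
stay under control because `[w] ^ (α * δ)` is bounded by an absolute constant. -/

section TreeMean

/-! ### Means and running maxima on a regular tree. -/

variable {T ι : Type*} [Fintype ι]

/-- The mean, over all descendants `R` of `Q` of generation `k`, of the payoff `F R M`, where `M` is
the maximum of `m` and of the values of `t` at the strict descendants of `Q` that are ancestors of
`R` or `R` itself. -/
noncomputable def treeMean (child : T → ι → T) (t : T → ℝ) (F : T → ℝ → ℝ) : ℕ → T → ℝ → ℝ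
  | 0, Q, m => F Q m
  | k + 1, Q, m => (Fintype.card ι : ℝ)⁻¹ *
      ∑ e, treeMean child t F k (child Q e) (max m (t (child Q e)))

variable {child : T → ι → T} {t : T → ℝ}

lemma card_inv_mul_sum_const [Nonempty ι] (c : ℝ) :
    (Fintype.card ι : ℝ)⁻¹ * ∑ _e : ι, c = c := by
  have : (Fintype.card ι : ℝ) ≠ 0 := by exact_mod_cast Fintype.card_ne_zero
  simp [Finset.sum_const, nsmul_eq_mul, this]

lemma card_inv_mul_sum_le {f g : ι → ℝ} (h : ∀ e, f e ≤ g e) :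
    (Fintype.card ι : ℝ)⁻¹ * ∑ e, f e ≤ (Fintype.card ι : ℝ)⁻¹ * ∑ e, g e :=
  mul_le_mul_of_nonneg_left (Finset.sum_le_sum fun e _ => h e) (by positivity)

lemma treeMean_linear (a b : ℝ) (F G : T → ℝ → ℝ) (k : ℕ) (Q : T) (m : ℝ) :
    treeMean child t (fun Q m => a * F Q m + b * G Q m) k Q m =
      a * treeMean child t F k Q m + b * treeMean child t G k Q m := by
  induction k generalizing Q m with
  | zero => rfl
  | succ k ih =>
    simp only [treeMean, ih, Finset.sum_add_distrib, ← Finset.mul_sum]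
    ring

/-- A payoff dominated by a potential which decreases in mean has mean at most the potential. -/
lemma treeMean_le_of_supersolution {F Ψ : T → ℝ → ℝ}
    (hF : ∀ Q m, t Q ≤ m → F Q m ≤ Ψ Q m)
    (hΨ : ∀ Q m, t Q ≤ m → (Fintype.card ι : ℝ)⁻¹ *
      ∑ e, Ψ (child Q e) (max m (t (child Q e))) ≤ Ψ Q m)
    (k : ℕ) {Q : T} {m : ℝ} (hm : t Q ≤ m) :
    treeMean child t F k Q m ≤ Ψ Q m := by
  induction k generalizing Q m with
  | zero => exact hF Q m hm
  | succ k ih =>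
    exact (card_inv_mul_sum_le fun e => ih (le_max_right _ _)).trans (hΨ Q m hm)

lemma treeMean_mono {F G : T → ℝ → ℝ} (hFG : ∀ Q m, t Q ≤ m → F Q m ≤ G Q m)
    (k : ℕ) {Q : T} {m : ℝ} (hm : t Q ≤ m) :
    treeMean child t F k Q m ≤ treeMean child t G k Q m := by
  induction k generalizing Q m with
  | zero => exact hFG Q m hm
  | succ k ih => exact card_inv_mul_sum_le fun e => ih (le_max_right _ _)

/-- Payoffs of the generation only, whose values average to the value of the parent. -/
lemma treeMean_of_mean {s : T → ℝ}
    (hs : ∀ Q, s Q = (Fintype.card ι : ℝ)⁻¹ * ∑ e, s (child Q e)) (k : ℕ) (Q : T) (m : ℝ) :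
    treeMean child t (fun Q _ => s Q) k Q m = s Q := by
  induction k generalizing Q m with
  | zero => rfl
  | succ k ih => simp only [treeMean, ih, ← hs]

/-- If `t ≤ A * u ^ α`, then the running maximum of `t` is at most `A` times the power of the
running maximum of `u`. -/
lemma treeMean_max_le {u : T → ℝ} {A α : ℝ} (hA : 0 ≤ A) (hα : 0 ≤ α) (hu : ∀ Q, 0 < u Q)
    (htu : ∀ Q, t Q ≤ A * u Q ^ α) (k : ℕ) (Q : T) {m h : ℝ} (hh : 0 < h)
    (hm : m ≤ A * h ^ α) :
    treeMean child t (fun _ m => m) k Q m ≤ A * treeMean child u (fun _ h => h ^ α) k Q h := by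
  induction k generalizing Q m h with
  | zero => exact hm
  | succ k ih =>
    have key : ∀ e, treeMean child t (fun _ m => m) k (child Q e) (max m (t (child Q e))) ≤
        A * treeMean child u (fun _ h => h ^ α) k (child Q e) (max h (u (child Q e))) := by
      intro e
      refine ih _ (lt_max_of_lt_left hh) (max_le ?_ ?_)
      · refine hm.trans ?_
        gcongr
        exact le_max_left _ _
      · refine (htu _).trans ?_
        have := (hu (child Q e)).le
        gcongr
        exact le_max_right _ _
    refine (card_inv_mul_sum_le key).trans (le_of_eq ?_)
    rw [← Finset.mul_sum]
    simp only [treeMean]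
    ring

end TreeMean

/-! ### Scalar inequalities. -/

/-- The pointwise inequality behind Doob's maximal inequality. -/
lemma rpow_sub_rpow_le_mul {α p a b : ℝ} (hα : 0 < α) (hp : p = 1 + 1 / α) (ha : 0 < a)
    (hb : 0 < b) : a ^ (1 + α) - b ^ (1 + α) ≤ p * (a * (a ^ α - b ^ α)) := by
  have hpα : p * α = 1 + α := by rw [hp]; field_simp; ring
  have hp0 : 0 < p := by rw [hp]; positivity
  have hp1 : 1 < p := by rw [hp]; linarith [show 0 < 1 / α by positivity]
  have hconj : Real.HolderConjugate p (1 + α) := by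
    rw [Real.holderConjugate_iff]
    refine ⟨hp1, ?_⟩
    rw [hp]; field_simp; ring
  have hy := Real.young_inequality_of_nonneg (a := b ^ α) (b := a) (by positivity) ha.le hconj
  rw [← Real.rpow_mul hb.le, mul_comm α p, hpα] at hy
  have e2 : a * a ^ α = a ^ (1 + α) := by rw [Real.rpow_add ha, Real.rpow_one]
  have h3 : p * (b ^ α * a) ≤ b ^ (1 + α) + a ^ (1 + α) / α := by
    calc p * (b ^ α * a) ≤ p * (b ^ (1 + α) / p + a ^ (1 + α) / (1 + α)) := by gcongr
      _ = b ^ (1 + α) + a ^ (1 + α) / α := by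
        rw [hp]; field_simp
        ring
  have h4 : p * a ^ (1 + α) = a ^ (1 + α) + a ^ (1 + α) / α := by rw [hp]; ring
  calc _ ≤ p * a ^ (1 + α) - p * (b ^ α * a) := by linarith
    _ = _ := by rw [← e2]; ring

/-- Young's inequality with the weights that absorb the maximal function. -/
lemma rpow_le_young {α p h v : ℝ} (hα : 0 < α) (hp : p = 1 + 1 / α) (hh : 0 < h) (hv : 0 < v) :
    h ^ α ≤ p⁻¹ * p⁻¹ * (v * h ^ (1 + α)) + (1 + α)⁻¹ * p ^ α * v⁻¹ ^ α := by
  have hpα : p * α = 1 + α := by rw [hp]; field_simp; ring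
  have hp0 : 0 < p := by rw [hp]; positivity
  have hp1 : 1 < p := by rw [hp]; linarith [show 0 < 1 / α by positivity]
  have hconj : Real.HolderConjugate p (1 + α) := by
    rw [Real.holderConjugate_iff]
    refine ⟨hp1, ?_⟩
    rw [hp]; field_simp; ring
  have hc : 0 < p⁻¹ * v := by positivity
  -- The weight `p⁻¹ * v` gives the first term the coefficient `p⁻¹ * p⁻¹`; Doob's inequality later
  -- costs a factor `p`, so `p⁻¹ < 1` remains and the term can be absorbed.
  have hy := Real.young_inequality_of_nonneg (a := h ^ α * (p⁻¹ * v) ^ p⁻¹)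
    (b := ((p⁻¹ * v) ^ p⁻¹)⁻¹) (by positivity) (by positivity) hconj
  rw [mul_assoc, mul_inv_cancel₀ (by positivity), mul_one, Real.mul_rpow (by positivity)
    (by positivity), ← Real.rpow_mul hh.le, mul_comm α p, hpα, Real.rpow_inv_rpow hc.le hp0.ne',
    ← Real.inv_rpow hc.le, ← Real.rpow_mul (by positivity),
    show p⁻¹ * (1 + α) = α by rw [← hpα]; field_simp, mul_inv, inv_inv,
    Real.mul_rpow hp0.le (by positivity)] at hy
  refine hy.trans (le_of_eq ?_)
  field_simp

/-- A chord inequality for the convex function `x ^ (1 + δ)` on `[1, N]`, scaled by `m`. -/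
lemma jump_le {N δ m t : ℝ} (hN : 1 < N) (hδ : 0 ≤ δ) (hm : 0 < m) (hmt : m ≤ t)
    (htN : t ≤ N * m) :
    (N ^ (1 + δ) - 1) * (t * (t ^ δ - m ^ δ)) ≤
      (N ^ (1 + δ) - N) * (t ^ (1 + δ) - m ^ (1 + δ)) := by
  have ht : 0 < t := hm.trans_le hmt
  have hconv := convexOn_rpow (show 1 ≤ 1 + δ by linarith)
  have hN0 : 0 < N := by linarith
  -- `t` is a convex combination of `m` and `N * m`.
  have h1 := hconv.2 (Set.mem_Ici.2 hm.le) (Set.mem_Ici.2 (show 0 ≤ N * m by positivity))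
   
    (show 0 ≤ (N * m - t) / (N * m - m) from div_nonneg (by linarith) (by nlinarith))
    (show 0 ≤ (t - m) / (N * m - m) from div_nonneg (by linarith) (by nlinarith))
    (by rw [← add_div, div_eq_one_iff_eq (by nlinarith)]; ring)
  have hd : 0 < N * m - m := by nlinarith
  have hN1 : N - 1 ≠ 0 := by linarith
  have e1 : (N * m - t) / (N * m - m) * m + (t - m) / (N * m - m) * (N * m) = t := by
    field_simp; ring
  simp only [smul_eq_mul] at h1
  rw [e1, Real.mul_rpow hN0.le hm.le, ← mul_le_mul_iff_right₀ hd] at h1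
  have e2 : (N * m - m) * ((N * m - t) / (N * m - m) * m ^ (1 + δ) +
      (t - m) / (N * m - m) * (N ^ (1 + δ) * m ^ (1 + δ))) =
      (N * m - t) * m ^ (1 + δ) + (t - m) * (N ^ (1 + δ) * m ^ (1 + δ)) := by
    field_simp
  rw [e2] at h1
  have e3 : m ^ (1 + δ) = m * m ^ δ := by rw [Real.rpow_add hm, Real.rpow_one]
  have e4 : t ^ (1 + δ) = t * t ^ δ := by rw [Real.rpow_add ht, Real.rpow_one]
  rw [e3] at h1 ⊢
  rw [e4] at h1 ⊢
  have h2 : m * ((N - 1) * (t * t ^ δ)) ≤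
      m * ((N * m - t) * m ^ δ + (t - m) * (N ^ (1 + δ) * m ^ δ)) := by nlinarith
  have h3 := le_of_mul_le_mul_left h2 hm
  nlinarith

/-! ### The reverse Hölder inequality on a tree. -/

section ReverseHolder

variable {T ι : Type*} [Fintype ι] {child : T → ι → T} {s v : T → ℝ}

/-- Doob's inequality: the running maximum of `1 / v`. -/
lemma treeMean_doob [Nonempty ι] {α p : ℝ} (hα : 0 < α) (hp : p = 1 + 1 / α) (hv0 : ∀ Q, 0 < v Q)
    (hv : ∀ Q, v Q = (Fintype.card ι : ℝ)⁻¹ * ∑ e, v (child Q e)) (k : ℕ) (Q : T) :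
    treeMean child (fun Q => (v Q)⁻¹) (fun Q h => v Q * h ^ (1 + α)) k Q (v Q)⁻¹ ≤
      p * treeMean child (fun Q => (v Q)⁻¹) (fun _ h => h ^ α) k Q (v Q)⁻¹ := by
  have hp1 : 1 < p := by rw [hp]; linarith [show 0 < 1 / α by positivity]
  -- The potential `v * h ^ (1 + α) - p * h ^ α` is linear in `v` while the maximum `h` is
  -- unchanged, and a jump does not raise it above that linear expression. At the start `h = v⁻¹` it
  -- equals `(1 - p) * h ^ α ≤ 0`.
  have h1 := treeMean_le_of_supersolution (child := child) (t := fun Q => (v Q)⁻¹)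
    (F := fun Q h => 1 * (v Q * h ^ (1 + α)) + (-p) * h ^ α)
    (Ψ := fun Q h => 1 * (v Q * h ^ (1 + α)) + (-p) * h ^ α)
    (fun _ _ _ => le_rfl) ?_ k (le_refl (v Q)⁻¹)
  · rw [treeMean_linear 1 (-p) (fun Q h => v Q * h ^ (1 + α)) (fun _ h => h ^ α)] at h1
    have hx : 0 < (v Q)⁻¹ := inv_pos.2 (hv0 Q)
    have e : v Q * (v Q)⁻¹ ^ (1 + α) = (v Q)⁻¹ ^ α := by
      rw [Real.rpow_add hx, Real.rpow_one, ← mul_assoc, mul_inv_cancel₀ (hv0 Q).ne', one_mul]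
    rw [e] at h1
    have : 0 < (v Q)⁻¹ ^ α := by positivity
    nlinarith
  · intro Q h hh
    have hh0 : 0 < h := (inv_pos.2 (hv0 Q)).trans_le hh
    have key : ∀ e, 1 * (v (child Q e) * (max h (v (child Q e))⁻¹) ^ (1 + α)) +
        (-p) * (max h (v (child Q e))⁻¹) ^ α ≤ v (child Q e) * h ^ (1 + α) + (-p) * h ^ α := by
      intro e
      rcases le_total (v (child Q e))⁻¹ h with hle | hle
      · rw [max_eq_left hle, one_mul]
      · rw [max_eq_right hle]
        have hve := hv0 (child Q e)
        have := mul_le_mul_of_nonneg_left (rpow_sub_rpow_le_mul hα hp (inv_pos.2 hve) hh0) hve.le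
        have e2 : v (child Q e) * (p * ((v (child Q e))⁻¹ * ((v (child Q e))⁻¹ ^ α - h ^ α))) =
            p * ((v (child Q e))⁻¹ ^ α - h ^ α) := by
          field_simp
        rw [e2] at this
        linarith
    refine (card_inv_mul_sum_le key).trans (le_of_eq ?_)
    rw [Finset.sum_add_distrib, mul_add, card_inv_mul_sum_const, ← Finset.sum_mul, ← mul_assoc,
      ← hv, one_mul]

/-- The mean of the maximal function of `s` is controlled by `s`. -/
lemma treeMean_max_le_mul [Nonempty ι] {A α p : ℝ} (hα : 0 < α) (hp : p = 1 + 1 / α) (hv0 : ∀ Q, 0 < v Q)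
    (hs : ∀ Q, s Q = (Fintype.card ι : ℝ)⁻¹ * ∑ e, s (child Q e))
    (hv : ∀ Q, v Q = (Fintype.card ι : ℝ)⁻¹ * ∑ e, v (child Q e)) (hA : 0 ≤ A)
    (h1 : ∀ Q, 1 ≤ s Q * v Q ^ α) (hsA : ∀ Q, s Q * v Q ^ α ≤ A) (k : ℕ) (Q : T) :
    treeMean child s (fun _ m => m) k Q (s Q) ≤ A * p ^ α * s Q := by
  have hp0 : 0 < p := by rw [hp]; positivity
  have hp1 : 1 < p := by rw [hp]; linarith [show 0 < 1 / α by positivity]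
  have hsu : ∀ Q, s Q ≤ A * (v Q)⁻¹ ^ α := fun Q => by
    have := hv0 Q
    rw [Real.inv_rpow this.le, ← div_eq_mul_inv, le_div_iff₀ (by positivity)]
    exact hsA Q
  have hus : ∀ Q, (v Q)⁻¹ ^ α ≤ s Q := fun Q => by
    have := hv0 Q
    rw [Real.inv_rpow this.le, inv_le_iff_one_le_mul₀ (by positivity)]
    exact h1 Q
  have hi : ∀ Q, 0 < (v Q)⁻¹ := fun Q => inv_pos.2 (hv0 Q)
  refine (treeMean_max_le hA hα.le hi hsu k Q (hi Q) (hsu Q)).trans ?_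
  rw [mul_assoc]
  refine mul_le_mul_of_nonneg_left ?_ hA
  have hd := treeMean_doob (child := child) hα hp hv0 hv k Q
  set Z := treeMean child (fun Q => (v Q)⁻¹) (fun _ h => h ^ α) k Q (v Q)⁻¹
  have hZ : Z ≤ p⁻¹ * p⁻¹ * treeMean child (fun Q => (v Q)⁻¹)
      (fun Q h => v Q * h ^ (1 + α)) k Q (v Q)⁻¹ + (1 + α)⁻¹ * p ^ α * s Q := by
    have h2 := treeMean_mono (child := child) (t := fun Q => (v Q)⁻¹) (F := fun _ h => h ^ α)
      (G := fun Q h => p⁻¹ * p⁻¹ * (v Q * h ^ (1 + α)) + (1 + α)⁻¹ * p ^ α * s Q)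
      (fun Q h hh => (rpow_le_young hα hp ((hi Q).trans_le hh) (hv0 Q)).trans (by
        gcongr; exact hus Q)) k (le_refl (v Q)⁻¹)
    rwa [treeMean_linear _ _ (fun Q h => v Q * h ^ (1 + α)) (fun Q _ => s Q),
      treeMean_of_mean hs] at h2
  have h3 : Z ≤ p⁻¹ * Z + (1 + α)⁻¹ * p ^ α * s Q := by
    refine hZ.trans ?_
    have := mul_le_mul_of_nonneg_left hd (show 0 ≤ p⁻¹ * p⁻¹ by positivity)
    have e : p⁻¹ * p⁻¹ * (p * Z) = p⁻¹ * Z := by field_simp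
    linarith
  have h4 : 1 - p⁻¹ = (1 + α)⁻¹ := by rw [hp]; field_simp; ring
  have h5 : (1 + α)⁻¹ * Z ≤ (1 + α)⁻¹ * (p ^ α * s Q) := by rw [← h4] at h3 ⊢; linarith
  exact le_of_mul_le_mul_left h5 (by positivity)

/-- Self-improvement of the bound for the mean of the maximal function. -/
lemma treeMean_max_rpow_le {B δ : ℝ} (hδ : 0 ≤ δ) (hs0 : ∀ Q, 0 < s Q)
    (hs : ∀ Q, s Q = (Fintype.card ι : ℝ)⁻¹ * ∑ e, s (child Q e))
    (hB : ∀ k Q, treeMean child s (fun _ m => m) k Q (s Q) ≤ B * s Q) (k : ℕ) (Q : T) :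
    treeMean child s (fun _ m => m ^ (1 + δ)) k Q (s Q) ≤
      B * treeMean child s (fun Q m => s Q * m ^ δ) k Q (s Q) := by
  -- Subtracting the `m ^ δ` terms makes both sides vanish at generation `0` and lets the induction
  -- run over every starting value `m`.
  have main : ∀ (k : ℕ) (Q : T) (m : ℝ), 0 < m →
      treeMean child s (fun _ m => m ^ (1 + δ)) k Q m -
        m ^ δ * treeMean child s (fun _ m => m) k Q m ≤
      B * (treeMean child s (fun Q m => s Q * m ^ δ) k Q m - m ^ δ * s Q) := by
    intro k
    induction k with
    | zero =>
      intro Q m hm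
      simp only [treeMean, Real.rpow_add hm, Real.rpow_one]
      apply le_of_eq; ring
    | succ k ih =>
      intro Q m hm
      have key : ∀ e, treeMean child s (fun _ m => m ^ (1 + δ)) k (child Q e)
            (max m (s (child Q e))) -
          m ^ δ * treeMean child s (fun _ m => m) k (child Q e) (max m (s (child Q e))) ≤
          B * (treeMean child s (fun Q m => s Q * m ^ δ) k (child Q e) (max m (s (child Q e))) -
            m ^ δ * s (child Q e)) := by
        intro e
        have h1 := ih (child Q e) (max m (s (child Q e))) (lt_max_of_lt_left hm)
        rcases le_total (s (child Q e)) m with hle | hle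
        · rwa [max_eq_left hle] at h1 ⊢
        · rw [max_eq_right hle] at h1 ⊢
          -- After a jump the maximum is the child's own value, which is the situation of `hB`; it
          -- pays for replacing `s (child Q e) ^ δ` by `m ^ δ`.
          have h2 := mul_le_mul_of_nonneg_left (hB k (child Q e))
            (sub_nonneg.2 (Real.rpow_le_rpow hm.le hle hδ))
          linarith
      have h3 := card_inv_mul_sum_le key
      rw [Finset.sum_sub_distrib, ← Finset.mul_sum, ← Finset.mul_sum, Finset.sum_sub_distrib,
        ← Finset.mul_sum] at h3
      rw [hs Q]
      simp only [treeMean]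
      linarith
  have h1 := main k Q (s Q) (hs0 Q)
  have h2 := mul_le_mul_of_nonneg_left (hB k Q) (show 0 ≤ s Q ^ δ from
    Real.rpow_nonneg (hs0 Q).le _)
  linarith

/-- Counterpart of `treeMean_max_rpow_le`. A child's value is at most `N` times its parent's, so
`jump_le` applies at each jump and makes the difference of the two means, with these coefficients,
decrease along the tree. At the start `m = s Q` it is `(N - 1) * s Q ^ (1 + δ)`. -/
lemma treeMean_mul_max_rpow_le [Nonempty ι] {δ N : ℝ} (hN : N = Fintype.card ι) (hN1 : 1 < N) (hδ : 0 ≤ δ)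
    (hs0 : ∀ Q, 0 < s Q) (hs : ∀ Q, s Q = (Fintype.card ι : ℝ)⁻¹ * ∑ e, s (child Q e))
    (k : ℕ) (Q : T) :
    (N ^ (1 + δ) - 1) * treeMean child s (fun Q m => s Q * m ^ δ) k Q (s Q) ≤
      (N - 1) * s Q ^ (1 + δ) +
      (N ^ (1 + δ) - N) * treeMean child s (fun _ m => m ^ (1 + δ)) k Q (s Q) := by
  have hN0 : 0 < N := by linarith
  have h1 := treeMean_le_of_supersolution (child := child) (t := s)
    (F := fun Q m => (N ^ (1 + δ) - 1) * (s Q * m ^ δ) + (-(N ^ (1 + δ) - N)) * m ^ (1 + δ))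
    (Ψ := fun Q m => (N ^ (1 + δ) - 1) * (s Q * m ^ δ) + (-(N ^ (1 + δ) - N)) * m ^ (1 + δ))
    (fun _ _ _ => le_rfl) ?_ k (le_refl (s Q))
  · rw [treeMean_linear _ _ (fun Q m => s Q * m ^ δ) (fun _ m => m ^ (1 + δ))] at h1
    have e : s Q * s Q ^ δ = s Q ^ (1 + δ) := by
      rw [Real.rpow_add (hs0 Q), Real.rpow_one]
    rw [e] at h1
    linarith
  · intro Q m hm
    have hm0 : 0 < m := (hs0 Q).trans_le hm
    have key : ∀ e, (N ^ (1 + δ) - 1) * (s (child Q e) * (max m (s (child Q e))) ^ δ) +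
        (-(N ^ (1 + δ) - N)) * (max m (s (child Q e))) ^ (1 + δ) ≤
        (N ^ (1 + δ) - 1) * m ^ δ * s (child Q e) + (-(N ^ (1 + δ) - N)) * m ^ (1 + δ) := by
      intro e
      rcases le_total (s (child Q e)) m with hle | hle
      · rw [max_eq_left hle]
        apply le_of_eq; ring
      · rw [max_eq_right hle]
        have hse : s (child Q e) ≤ N * m := by
          have h2 : s (child Q e) ≤ ∑ e, s (child Q e) :=
            Finset.single_le_sum (f := fun e => s (child Q e)) (fun e _ => (hs0 _).le)
              (Finset.mem_univ e)
          have h3 : ∑ e, s (child Q e) = N * s Q := by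
            rw [hs Q, ← hN]; field_simp
          rw [h3] at h2
          exact h2.trans (by gcongr)
        have := jump_le hN1 hδ hm0 hle hse
        linarith
    refine (card_inv_mul_sum_le key).trans (le_of_eq ?_)
    rw [Finset.sum_add_distrib, mul_add, card_inv_mul_sum_const, ← Finset.mul_sum,
      mul_left_comm, ← hs]
    ring

/-- Smallness needed for the absorption. With `x = δ * log N` one has `N ^ δ - 1 ≤ x / (1 - x)`,
while `x * N * B ≤ log N` and `log N ≤ N`. -/
lemma sub_mul_rpow_sub_one_le {N B δ : ℝ} (hN : 1 < N) (hB : 1 ≤ B) (hδ : 0 ≤ δ)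
    (hδB : δ * (N * B) ≤ 1) : (B - 1) * (N * (N ^ δ - 1)) ≤ Real.log N := by
  have hN0 : 0 < N := by linarith
  have hL : 0 < Real.log N := Real.log_pos hN
  have hLN : Real.log N ≤ N - 1 := Real.log_le_sub_one_of_pos hN0
  set x := Real.log N * δ with hx
  have hx0 : 0 ≤ x := by positivity
  have hxB : x * (N * B) ≤ Real.log N := by
    rw [hx, mul_assoc]; nlinarith
  have hxN : x * N ≤ Real.log N := by nlinarith [mul_nonneg hx0 hN0.le]
  have hx1 : x < 1 := by nlinarith
  have hexp : N ^ δ * (1 - x) ≤ 1 := by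
    rw [Real.rpow_def_of_pos hN0, ← hx]
    have := Real.add_one_le_exp (-x)
    calc Real.exp x * (1 - x) ≤ Real.exp x * Real.exp (-x) := by gcongr; linarith
      _ = 1 := by rw [← Real.exp_add]; simp
  have h1 : (N ^ δ - 1) * (1 - x) ≤ x := by linarith
  have h2 : (B - 1) * (N * (N ^ δ - 1)) * (1 - x) ≤ (B - 1) * N * x := by
    have := mul_le_mul_of_nonneg_left h1 (show 0 ≤ (B - 1) * N by nlinarith)
    linarith
  have h3 : (B - 1) * N * x ≤ Real.log N * (1 - x) := by nlinarith
  exact le_of_mul_le_mul_right (h2.trans h3) (by linarith)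

/-- The reverse Hölder inequality on trees. -/
theorem treeMean_rpow_le [Nonempty ι] {A α p δ N : ℝ} (hN : N = Fintype.card ι) (hN1 : 1 < N)
    (hα : 0 < α) (hp : p = 1 + 1 / α) (hδ : 0 ≤ δ) (hδA : δ * (N * (A * p ^ α)) ≤ 1)
    (hs0 : ∀ Q, 0 < s Q) (hv0 : ∀ Q, 0 < v Q)
    (hs : ∀ Q, s Q = (Fintype.card ι : ℝ)⁻¹ * ∑ e, s (child Q e))
    (hv : ∀ Q, v Q = (Fintype.card ι : ℝ)⁻¹ * ∑ e, v (child Q e))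
    (h1 : ∀ Q, 1 ≤ s Q * v Q ^ α) (hsA : ∀ Q, s Q * v Q ^ α ≤ A) (k : ℕ) (Q : T) :
    (N - 1 - Real.log N) * treeMean child s (fun Q _ => s Q ^ (1 + δ)) k Q (s Q) ≤
      (N - 1) * s Q ^ (1 + δ) := by
  have hN0 : 0 < N := by linarith
  have hA1 : 1 ≤ A := (h1 Q).trans (hsA Q)
  have hp1 : 1 < p := by rw [hp]; linarith [show 0 < 1 / α by positivity]
  set B := A * p ^ α with hBdef
  have hB1 : 1 ≤ B := one_le_mul_of_one_le_of_one_le hA1 (Real.one_le_rpow hp1.le hα.le)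
  have hFW := treeMean_max_le_mul (child := child) hα hp hv0 hs hv (by linarith) h1 hsA
  have hU := treeMean_max_rpow_le (child := child) hδ hs0 hs hFW k Q
  have hV := treeMean_mul_max_rpow_le (child := child) hN hN1 hδ hs0 hs k Q
  have hle := treeMean_mono (child := child) (t := s) (F := fun Q _ => s Q ^ (1 + δ))
    (G := fun Q m => s Q * m ^ δ) (fun Q m hm => by
      rw [Real.rpow_add (hs0 Q), Real.rpow_one]
      have := (hs0 Q).le
      gcongr) k (le_refl (s Q))
  set V := treeMean child s (fun Q m => s Q * m ^ δ) k Q (s Q)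
  set X := treeMean child s (fun Q _ => s Q ^ (1 + δ)) k Q (s Q)
  have hP : N ^ (1 + δ) = N * N ^ δ := by rw [Real.rpow_add hN0, Real.rpow_one]
  have hNδ : 1 ≤ N ^ δ := Real.one_le_rpow hN1.le hδ
  have hX0 : 0 ≤ X := by
    have : ∀ (k : ℕ) (Q : T) (m : ℝ), 0 ≤ treeMean child s (fun Q _ => s Q ^ (1 + δ)) k Q m := by
      intro k
      induction k with
      | zero => exact fun Q m => Real.rpow_nonneg (hs0 Q).le _
      | succ k ih =>
        exact fun Q m => mul_nonneg (by positivity) (Finset.sum_nonneg fun e _ => ih _ _)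
    exact this k Q _
  have hlog := sub_mul_rpow_sub_one_le hN1 hB1 hδ hδA
  have hU' := mul_le_mul_of_nonneg_left hU (show 0 ≤ N ^ (1 + δ) - N by rw [hP]; nlinarith)
  rw [hP] at hV hU'
  have hlogN : 0 ≤ N - 1 - Real.log N := by linarith [Real.log_le_sub_one_of_pos hN0]
  calc (N - 1 - Real.log N) * X ≤ (N - 1 - Real.log N) * V := by gcongr
    -- This is the coefficient of `V` once `hU'` has eliminated the mean of `M ^ (1 + δ)` from `hV`.
    _ ≤ (N - 1 - (B - 1) * (N * (N ^ δ - 1))) * V := by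
        have : 0 ≤ V := hX0.trans hle
        gcongr
    _ ≤ (N - 1) * s Q ^ (1 + δ) := by linarith

end ReverseHolder

/-! ### Dyadic subcubes, half-open so that children partition their parent. -/

/-- A nondegenerate cube with sides parallel to the axes. -/
structure AxisCube (d : ℕ) where
  /-- The lower corner. -/
  corner : Fin d → ℝ
  /-- The side length. -/
  side : ℝ
  side_pos : 0 < side

namespace AxisCube

variable {d : ℕ}

/-- The half-open cube. -/
def toSet (Q : AxisCube d) : Set (Fin d → ℝ) :=
  Set.univ.pi fun i => Set.Ico (Q.corner i) (Q.corner i + Q.side)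

/-- The dyadic children, indexed by the choice of an upper or lower half in each coordinate. -/
noncomputable def child (Q : AxisCube d) (e : Fin d → Bool) : AxisCube d where
  corner i := Q.corner i + if e i then Q.side / 2 else 0
  side := Q.side / 2
  side_pos := half_pos Q.side_pos

/-- The index of the child containing a given point of the cube. -/
noncomputable def code (Q : AxisCube d) (x : Fin d → ℝ) : Fin d → Bool :=
  fun i => decide (Q.corner i + Q.side / 2 ≤ x i)

lemma mem_child_iff (Q : AxisCube d) (e : Fin d → Bool) (x : Fin d → ℝ) :
    x ∈ (Q.child e).toSet ↔ x ∈ Q.toSet ∧ Q.code x = e := by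
  simp only [toSet, child, code, Set.mem_univ_pi, Set.mem_Ico, funext_iff]
  rw [← forall_and]
  refine forall_congr' fun i => ?_
  have := Q.side_pos
  cases e i
  · simp only [decide_eq_false_iff_not, not_le, Bool.false_eq_true, if_false]
    constructor
    · rintro ⟨h1, h2⟩
      exact ⟨⟨by linarith, by linarith⟩, by linarith⟩
    · rintro ⟨⟨h1, h2⟩, h3⟩
      exact ⟨by linarith, by linarith⟩
  · simp only [decide_eq_true_eq, if_true]
    constructor
    · rintro ⟨h1, h2⟩
      exact ⟨⟨by linarith, by linarith⟩, by linarith⟩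
    · rintro ⟨⟨h1, h2⟩, h3⟩
      exact ⟨by linarith, by linarith⟩

lemma measurableSet_toSet (Q : AxisCube d) : MeasurableSet Q.toSet :=
  MeasurableSet.univ_pi fun _ => measurableSet_Ico

lemma measurable_code (Q : AxisCube d) : Measurable Q.code := by
  refine measurable_pi_lambda _ fun i => ?_
  refine measurable_to_bool ?_
  have : (fun x : Fin d → ℝ => Q.code x i) ⁻¹' {true} = {x | Q.corner i + Q.side / 2 ≤ x i} := by
    ext x; simp [code]
  rw [this]
  exact measurableSet_le measurable_const (measurable_pi_apply i)

lemma toSet_ae_eq (Q : AxisCube d) : Q.toSet =ᵐ[volume] cube Q.corner Q.side :=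
  Measure.univ_pi_Ico_ae_eq_Icc

lemma volume_toSet (Q : AxisCube d) : volume Q.toSet = ENNReal.ofReal Q.side ^ d := by
  simp [toSet, Real.volume_pi_Ico]

lemma volume_cube (Q : AxisCube d) :
    volume (cube Q.corner Q.side) = ENNReal.ofReal Q.side ^ d := by
  rw [← measure_congr Q.toSet_ae_eq, volume_toSet]

lemma volume_toSet_ne_zero (Q : AxisCube d) : volume Q.toSet ≠ 0 := by
  rw [volume_toSet]
  exact pow_ne_zero _ (ENNReal.ofReal_pos.2 Q.side_pos).ne'

lemma volume_toSet_ne_top (Q : AxisCube d) : volume Q.toSet ≠ ∞ := by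
  rw [volume_toSet]
  exact ENNReal.pow_ne_top ENNReal.ofReal_ne_top

lemma volume_child (Q : AxisCube d) (e : Fin d → Bool) :
    volume Q.toSet = 2 ^ d * volume (Q.child e).toSet := by
  rw [volume_toSet, volume_toSet, ← mul_pow]
  congr 1
  rw [← ENNReal.ofReal_ofNat 2, ← ENNReal.ofReal_mul (by norm_num)]
  simp only [child]
  congr 1
  ring

lemma setLIntegral_toSet (Q : AxisCube d) (f : (Fin d → ℝ) → ℝ≥0∞) :
    ∫⁻ x in Q.toSet, f x = ∑ e, ∫⁻ x in (Q.child e).toSet, f x := by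
  have hU : Q.toSet = ⋃ e, (Q.child e).toSet := by
    ext x
    simp [mem_child_iff]
  rw [hU, lintegral_iUnion (fun e => (Q.child e).measurableSet_toSet), tsum_fintype]
  intro e e' hee'
  refine Set.disjoint_left.2 fun x hx hx' => hee' ?_
  rw [mem_child_iff] at hx hx'
  exact hx.2.symm.trans hx'.2

lemma setLAverage_toSet (Q : AxisCube d) (f : (Fin d → ℝ) → ℝ≥0∞) :
    ⨍⁻ x in Q.toSet, f x ∂volume =
      (2 ^ d)⁻¹ * ∑ e, ⨍⁻ x in (Q.child e).toSet, f x ∂volume := by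
  simp only [setLAverage_eq]
  rw [setLIntegral_toSet, Finset.mul_sum, ENNReal.div_eq_inv_mul, Finset.mul_sum]
  refine Finset.sum_congr rfl fun e _ => ?_
  rw [volume_child Q e, ENNReal.div_eq_inv_mul, ← mul_assoc,
    ENNReal.mul_inv (Or.inr (Q.child e).volume_toSet_ne_top) (Or.inl (by simp))]

lemma setLAverage_cube (Q : AxisCube d) (f : (Fin d → ℝ) → ℝ≥0∞) :
    ⨍⁻ x in cube Q.corner Q.side, f x ∂volume = ⨍⁻ x in Q.toSet, f x ∂volume :=
  setLAverage_congr Q.toSet_ae_eq.symm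

/-- The dyadic descendant of generation `k` containing a given point. -/
noncomputable def leaf : ℕ → AxisCube d → (Fin d → ℝ) → AxisCube d
  | 0, Q, _ => Q
  | k + 1, Q, x => leaf k (Q.child (Q.code x)) x

lemma side_leaf (k : ℕ) (Q : AxisCube d) (x : Fin d → ℝ) :
    (leaf k Q x).side = Q.side * (1 / 2) ^ k := by
  induction k generalizing Q with
  | zero => simp [leaf]
  | succ k ih =>
    rw [leaf, ih, child, pow_succ]
    ring

lemma mem_leaf (k : ℕ) {Q : AxisCube d} {x : Fin d → ℝ} (hx : x ∈ Q.toSet) :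
    x ∈ (leaf k Q x).toSet := by
  induction k generalizing Q with
  | zero => exact hx
  | succ k ih => exact ih ((mem_child_iff _ _ _).2 ⟨hx, rfl⟩)

/-- The leaf depends on the point only through finitely many codes, so `G` may be arbitrary. -/
lemma measurable_comp_leaf {γ : Type*} [MeasurableSpace γ] (G : AxisCube d → γ) (k : ℕ)
    (Q : AxisCube d) : Measurable fun x => G (leaf k Q x) := by
  induction k generalizing Q with
  | zero => simpa only [leaf] using measurable_const
  | succ k ih =>
    have h : Measurable fun z : (Fin d → ℝ) × (Fin d → Bool) => G (leaf k (Q.child z.2) z.1) :=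
      measurable_from_prod_countable_left fun e => ih (Q.child e)
    exact h.comp (measurable_id.prodMk Q.measurable_code)

lemma card_index : (Fintype.card (Fin d → Bool) : ℝ) = 2 ^ d := by simp

lemma ofReal_inv_card_mul_sum {g : (Fin d → Bool) → ℝ} (hg : ∀ e, 0 ≤ g e) :
    ENNReal.ofReal ((Fintype.card (Fin d → Bool) : ℝ)⁻¹ * ∑ e, g e) =
      (2 ^ d)⁻¹ * ∑ e, ENNReal.ofReal (g e) := by
  rw [ENNReal.ofReal_mul (by positivity), ENNReal.ofReal_sum_of_nonneg fun e _ => hg e,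
    card_index, ENNReal.ofReal_inv_of_pos (by positivity), ENNReal.ofReal_pow (by norm_num),
    ENNReal.ofReal_ofNat]

/-- Means over the dyadic tree are averages of functions of the leaf. -/
lemma setLAverage_comp_leaf {t G : AxisCube d → ℝ} (hG : ∀ Q, 0 ≤ G Q) (k : ℕ)
    (Q : AxisCube d) (m : ℝ) :
    ⨍⁻ x in Q.toSet, ENNReal.ofReal (G (leaf k Q x)) ∂volume =
      ENNReal.ofReal (treeMean child t (fun Q _ => G Q) k Q m) := by
  have hnn : ∀ (k : ℕ) (Q : AxisCube d) (m : ℝ), 0 ≤ treeMean child t (fun Q _ => G Q) k Q m := by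
    intro k
    induction k with
    | zero => exact fun Q _ => hG Q
    | succ k ih => exact fun Q m => mul_nonneg (by positivity) (Finset.sum_nonneg fun e _ => ih _ _)
  induction k generalizing Q m with
  | zero =>
    simp only [leaf, treeMean]
    exact setLAverage_const Q.volume_toSet_ne_zero Q.volume_toSet_ne_top _
  | succ k ih =>
    rw [setLAverage_toSet, treeMean, ofReal_inv_card_mul_sum fun e => hnn _ _ _]
    congr 1
    refine Finset.sum_congr rfl fun e _ => ?_
    rw [← ih]
    simp only [setLAverage_eq]
    congr 1
    refine setLIntegral_congr_fun (Q.child e).measurableSet_toSet fun x hx => ?_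
    rw [mem_child_iff] at hx
    simp only [leaf, hx.2]

/-! ### From averages over dyadic cubes to functions. -/

lemma cube_eq_closedBall (Q : AxisCube d) :
    cube Q.corner Q.side = Metric.closedBall (fun i => Q.corner i + Q.side / 2) (Q.side / 2) := by
  rw [cube, ← Set.pi_univ_Icc, closedBall_pi _ (half_pos Q.side_pos).le]
  simp only [Real.closedBall_eq_Icc]
  congr! 3 <;> ring

/-- Lebesgue differentiation along the dyadic descendants. -/
lemma ae_tendsto_average_leaf {f : (Fin d → ℝ) → ℝ} (hf : LocallyIntegrable f volume)
    (Q : AxisCube d) :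
    ∀ᵐ x ∂(volume.restrict Q.toSet), Filter.Tendsto
      (fun k => ⨍ y in cube (leaf k Q x).corner (leaf k Q x).side, f y) Filter.atTop
      (nhds (f x)) := by
  -- Leaves contain `x` but are not centred there; the parameter `1` allows any balls containing
  -- `x`.
  have h := ae_restrict_of_ae (s := Q.toSet)
    (IsUnifLocDoublingMeasure.ae_tendsto_average volume hf 1)
  filter_upwards [h, ae_restrict_mem Q.measurableSet_toSet] with x hx hxQ
  simp only [cube_eq_closedBall]
  refine hx _ _ ?_ (Filter.Eventually.of_forall fun k => ?_)
  · rw [tendsto_nhdsWithin_iff]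
    refine ⟨?_, Filter.Eventually.of_forall fun k => half_pos (leaf k Q x).side_pos⟩
    have h0 : Filter.Tendsto (fun k : ℕ => Q.side * (1 / 2 : ℝ) ^ k / 2) Filter.atTop
        (nhds (Q.side * 0 / 2)) :=
      ((tendsto_pow_atTop_nhds_zero_of_lt_one (by norm_num) (by norm_num)).const_mul _).div_const _
    simpa only [side_leaf, mul_zero, zero_div] using h0
  · rw [one_mul, ← cube_eq_closedBall]
    have h1 := mem_leaf k hxQ
    rw [toSet, Set.mem_univ_pi] at h1
    exact ⟨fun i => (h1 i).1, fun i => (h1 i).2.le⟩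

/-- The mean value of a function over a cube. -/
noncomputable def avg (f : (Fin d → ℝ) → ℝ) (Q : AxisCube d) : ℝ :=
  ⨍ x in cube Q.corner Q.side, f x

lemma integrableOn_cube {f : (Fin d → ℝ) → ℝ} (hf : LocallyIntegrable f volume)
    (Q : AxisCube d) : IntegrableOn f (cube Q.corner Q.side) volume :=
  hf.integrableOn_isCompact isCompact_Icc

lemma ofReal_avg {f : (Fin d → ℝ) → ℝ} (hf : LocallyIntegrable f volume)
    (hf0 : ∀ᵐ x ∂(volume : Measure (Fin d → ℝ)), 0 < f x) (Q : AxisCube d) :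
    ENNReal.ofReal (avg f Q) = ⨍⁻ x in cube Q.corner Q.side, ENNReal.ofReal (f x) ∂volume := by
  rw [avg, ofReal_setAverage (integrableOn_cube hf Q)
    (ae_restrict_of_ae (hf0.mono fun x hx => hx.le)), setLAverage_eq]

lemma setLAverage_cube_ne_zero {f : (Fin d → ℝ) → ℝ} (hfm : AEMeasurable f volume)
    (hf0 : ∀ᵐ x ∂(volume : Measure (Fin d → ℝ)), 0 < f x) (Q : AxisCube d) :
    ⨍⁻ x in cube Q.corner Q.side, ENNReal.ofReal (f x) ∂volume ≠ 0 := by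
  rw [setLAverage_cube, setLAverage_eq]
  refine (ENNReal.div_pos ?_ Q.volume_toSet_ne_top).ne'
  intro h
  rw [lintegral_eq_zero_iff' hfm.restrict.ennreal_ofReal] at h
  have h2 : ∀ᵐ x ∂(volume.restrict Q.toSet), False := by
    filter_upwards [h, ae_restrict_of_ae hf0] with x hx hx0
    simp only [Pi.zero_apply, ENNReal.ofReal_eq_zero] at hx
    linarith
  rw [Filter.eventually_false_iff_eq_bot, ae_eq_bot, Measure.restrict_eq_zero] at h2
  exact Q.volume_toSet_ne_zero h2

lemma avg_pos {f : (Fin d → ℝ) → ℝ} (hf : LocallyIntegrable f volume)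
    (hf0 : ∀ᵐ x ∂(volume : Measure (Fin d → ℝ)), 0 < f x) (Q : AxisCube d) : 0 < avg f Q := by
  rw [← ENNReal.ofReal_pos, ofReal_avg hf hf0, pos_iff_ne_zero]
  exact setLAverage_cube_ne_zero hf.aestronglyMeasurable.aemeasurable hf0 Q

lemma avg_eq_mean {f : (Fin d → ℝ) → ℝ} (hf : LocallyIntegrable f volume)
    (hf0 : ∀ᵐ x ∂(volume : Measure (Fin d → ℝ)), 0 < f x) (Q : AxisCube d) :
    avg f Q = (Fintype.card (Fin d → Bool) : ℝ)⁻¹ * ∑ e, avg f (Q.child e) := by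
  have h0 := fun Q => (avg_pos hf hf0 Q).le
  rw [← ENNReal.ofReal_eq_ofReal_iff (h0 Q)
    (mul_nonneg (by positivity) (Finset.sum_nonneg fun e _ => h0 _)),
    ofReal_inv_card_mul_sum fun e => h0 _]
  simp only [ofReal_avg hf hf0, setLAverage_cube]
  exact setLAverage_toSet _ _

/-- If means over the leaves of all generations are bounded, so is the average. -/
lemma setLAverage_le_of_leaf {f : (Fin d → ℝ) → ℝ} (hf : LocallyIntegrable f volume)
    {G : ℝ → ℝ} (hG : Continuous G) (Q : AxisCube d) {c : ℝ≥0∞}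
    (h : ∀ k, ⨍⁻ x in Q.toSet, ENNReal.ofReal (G (avg f (leaf k Q x))) ∂volume ≤ c) :
    ⨍⁻ x in cube Q.corner Q.side, ENNReal.ofReal (G (f x)) ∂volume ≤ c := by
  rw [setLAverage_cube, setLAverage_eq, ENNReal.div_le_iff Q.volume_toSet_ne_zero
    Q.volume_toSet_ne_top]
  calc ∫⁻ x in Q.toSet, ENNReal.ofReal (G (f x))
      = ∫⁻ x in Q.toSet, Filter.liminf
          (fun k => ENNReal.ofReal (G (avg f (leaf k Q x)))) Filter.atTop := by
        refine lintegral_congr_ae ?_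
        filter_upwards [ae_tendsto_average_leaf hf Q] with x hx
        exact (((ENNReal.continuous_ofReal.comp hG).tendsto _).comp hx).liminf_eq.symm
    _ ≤ Filter.liminf (fun k => ∫⁻ x in Q.toSet,
          ENNReal.ofReal (G (avg f (leaf k Q x)))) Filter.atTop :=
        lintegral_liminf_le fun k =>
          measurable_comp_leaf (fun R => ENNReal.ofReal (G (avg f R))) k Q
    _ ≤ c * volume Q.toSet := by
        refine Filter.liminf_le_of_le (by isBoundedDefault) fun b hb => ?_
        obtain ⟨k, hk⟩ := hb.exists
        refine hk.trans ?_
        have := h k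
        rwa [setLAverage_eq, ENNReal.div_le_iff Q.volume_toSet_ne_zero
          Q.volume_toSet_ne_top] at this

/-- The reverse Hölder inequality for a pair of functions satisfying the Muckenhoupt condition. -/
theorem setLAverage_rpow_le (hd : 1 ≤ d) {f g : (Fin d → ℝ) → ℝ}
    (hf : LocallyIntegrable f volume) (hf0 : ∀ᵐ x ∂(volume : Measure (Fin d → ℝ)), 0 < f x)
    (hg : LocallyIntegrable g volume) (hg0 : ∀ᵐ x ∂(volume : Measure (Fin d → ℝ)), 0 < g x)
    {A α p δ : ℝ} (hα : 0 < α) (hp : p = 1 + 1 / α) (hδ : 0 ≤ δ)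
    (hδA : δ * ((2 : ℝ) ^ d * (A * p ^ α)) ≤ 1)
    (h1 : ∀ Q, 1 ≤ avg f Q * avg g Q ^ α) (hA : ∀ Q, avg f Q * avg g Q ^ α ≤ A)
    (Q : AxisCube d) :
    ⨍⁻ x in cube Q.corner Q.side, ENNReal.ofReal (f x ^ (1 + δ)) ∂volume ≤
      ENNReal.ofReal (((2 : ℝ) ^ d - 1) / ((2 : ℝ) ^ d - 1 - Real.log (2 ^ d)) *
        avg f Q ^ (1 + δ)) := by
  have hN1 : (1 : ℝ) < 2 ^ d := one_lt_pow₀ (by norm_num) (by omega)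
  have hlog : 0 < (2 : ℝ) ^ d - 1 - Real.log (2 ^ d) := by
    linarith [Real.log_lt_sub_one_of_pos (by positivity : (0 : ℝ) < 2 ^ d) hN1.ne']
  refine setLAverage_le_of_leaf hf (Real.continuous_rpow_const (by linarith : 0 ≤ 1 + δ)) Q
    fun k => ?_
  rw [setLAverage_comp_leaf (t := avg f) (G := fun R => avg f R ^ (1 + δ))
    (fun R => Real.rpow_nonneg (avg_pos hf hf0 R).le _) k Q (avg f Q)]
  refine ENNReal.ofReal_le_ofReal ?_
  rw [div_mul_eq_mul_div, le_div_iff₀ hlog, mul_comm]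
  exact treeMean_rpow_le card_index.symm hN1 hα hp hδ hδA (avg_pos hf hf0) (avg_pos hg hg0)
    (avg_eq_mean hf hf0) (avg_eq_mean hg hg0) h1 hA k Q

/-- The lower bound in the Muckenhoupt condition, from the tangent of `x ^ (-α)`. -/
lemma one_le_avg_mul {f g : (Fin d → ℝ) → ℝ} {α : ℝ} (hα : 0 < α)
    (hf : LocallyIntegrable f volume) (hg : LocallyIntegrable g volume)
    (hg0 : ∀ᵐ x ∂(volume : Measure (Fin d → ℝ)), 0 < g x)
    (hfg : ∀ x, f x = g x ^ (-α)) (Q : AxisCube d) : 1 ≤ avg f Q * avg g Q ^ α := by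
  have hv := avg_pos hg hg0 Q
  set v := avg g Q with hvdef
  have hμ : volume (cube Q.corner Q.side) ≠ 0 := by
    rw [volume_cube, ← volume_toSet]; exact Q.volume_toSet_ne_zero
  have hμ' : volume (cube Q.corner Q.side) ≠ ∞ := by
    rw [volume_cube, ← volume_toSet]; exact Q.volume_toSet_ne_top
  have tangent : ∀ᵐ x ∂(volume.restrict (cube Q.corner Q.side)),
      v ^ (-α) * (1 + α) - v ^ (-α) * α * v⁻¹ * g x ≤ f x := by
    filter_upwards [ae_restrict_of_ae hg0] with x hx
    have h1 : 1 - α * (g x / v - 1) ≤ (g x / v) ^ (-α) := by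
      rw [Real.rpow_def_of_pos (div_pos hx hv)]
      have := Real.add_one_le_exp (Real.log (g x / v) * -α)
      have := Real.log_le_sub_one_of_pos (div_pos hx hv)
      nlinarith
    rw [Real.div_rpow hx.le hv.le, ← hfg, le_div_iff₀ (by positivity)] at h1
    refine (le_of_eq ?_).trans h1
    field_simp
    ring
  have hc : Integrable (fun _ => v ^ (-α) * (1 + α)) (volume.restrict (cube Q.corner Q.side)) :=
    integrableOn_const hμ'
  have hk : Integrable (fun x => v ^ (-α) * α * v⁻¹ * g x)
      (volume.restrict (cube Q.corner Q.side)) := (integrableOn_cube hg Q).const_mul _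
  have hck : Integrable (fun x => v ^ (-α) * (1 + α) - v ^ (-α) * α * v⁻¹ * g x)
      (volume.restrict (cube Q.corner Q.side)) := hc.sub hk
  have hint := integral_mono_ae hck (integrableOn_cube hf Q) tangent
  have hM : 0 < (volume : Measure (Fin d → ℝ)).real (cube Q.corner Q.side) :=
    ENNReal.toReal_pos hμ hμ'
  have ef : avg f Q * volume.real (cube Q.corner Q.side) = ∫ x in cube Q.corner Q.side, f x := by
    rw [avg, setAverage_eq, smul_eq_mul]; field_simp
  have eg : v * volume.real (cube Q.corner Q.side) = ∫ x in cube Q.corner Q.side, g x := by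
    rw [hvdef, avg, setAverage_eq, smul_eq_mul]; field_simp
  rw [integral_sub hc hk, setIntegral_const, ← ef, integral_const_mul (v ^ (-α) * α * v⁻¹), ← eg,
    smul_eq_mul] at hint
  have h3 : v ^ (-α) ≤ avg f Q := by
    refine le_of_mul_le_mul_right (le_trans (le_of_eq ?_) hint) hM
    field_simp
    ring
  calc (1 : ℝ) = v ^ (-α) * v ^ α := by rw [← Real.rpow_add hv]; simp
    _ ≤ _ := by gcongr

end AxisCube

/-! ### Numerical constants. -/

/-- The worst case is `d = 1`, because `d ≤ 2 ^ d - 1`. -/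
lemma two_pow_sub_one_div_le {d : ℕ} (hd : 1 ≤ d) :
    ((2 : ℝ) ^ d - 1) / ((2 : ℝ) ^ d - 1 - Real.log (2 ^ d)) ≤ (1 - Real.log 2)⁻¹ := by
  have hN1 : (1 : ℝ) < 2 ^ d := one_lt_pow₀ (by norm_num) (by omega)
  have hlog : 0 < (2 : ℝ) ^ d - 1 - Real.log (2 ^ d) := by
    linarith [Real.log_lt_sub_one_of_pos (by positivity : (0 : ℝ) < 2 ^ d) hN1.ne']
  have h2 : 0 < 1 - Real.log 2 := by linarith [Real.log_two_lt_d9]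
  have h3 : (d : ℝ) ≤ 2 ^ d - 1 := by
    have := one_add_mul_le_pow (show (-2 : ℝ) ≤ 1 by norm_num) d
    norm_num at this
    linarith
  rw [inv_eq_one_div, div_le_div_iff₀ hlog h2, Real.log_pow]
  nlinarith [Real.log_pos (show (1 : ℝ) < 2 by norm_num)]

/-- From `log A ≤ A / e` follows `δ * log A ≤ 1 / (2 * e) < 0.184`, hence `A ^ δ ≤ 1 / 0.816`. The
product is just below `4`. -/
lemma inv_one_sub_log_two_mul_rpow_le {A δ : ℝ} (hA : 1 ≤ A) (hδ : 0 ≤ δ) (hδA : δ * (2 * A) ≤ 1) :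
    (1 - Real.log 2)⁻¹ * A ^ δ ≤ 4 := by
  have hA0 : 0 < A := by linarith
  have he := Real.exp_one_gt_d9
  have h1 : Real.log A * Real.exp 1 ≤ A := by
    have := Real.log_le_sub_one_of_pos (show 0 < A / Real.exp 1 by positivity)
    rw [Real.log_div hA0.ne' (Real.exp_pos 1).ne', Real.log_exp] at this
    have : Real.log A ≤ A / Real.exp 1 := by linarith
    rwa [le_div_iff₀ (Real.exp_pos 1)] at this
  have hL := Real.log_nonneg hA
  have hx : Real.log A * δ ≤ 0.184 := by
    have h3 : (Real.log A * δ) * Real.exp 1 ≤ 1 / 2 := by nlinarith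
    have : 0 ≤ Real.log A * δ := by positivity
    nlinarith
  have h4 : A ^ δ * 0.816 ≤ 1 := by
    rw [Real.rpow_def_of_pos hA0]
    have h5 := Real.add_one_le_exp (-(Real.log A * δ))
    calc Real.exp (Real.log A * δ) * 0.816
        ≤ Real.exp (Real.log A * δ) * Real.exp (-(Real.log A * δ)) := by
          gcongr; linarith
      _ = 1 := by rw [← Real.exp_add]; simp
  have h2 : 0.3068528 < 1 - Real.log 2 := by linarith [Real.log_two_lt_d9]
  rw [inv_mul_le_iff₀ (by linarith)]
  linarith

/-! ### The `A_p` condition on cubes and the dual weight. -/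

namespace AxisCube

variable {d : ℕ}

lemma mul_le_eApChar (p : ℝ) (w : (Fin d → ℝ) → ℝ) (Q : AxisCube d) :
    (⨍⁻ x in cube Q.corner Q.side, ENNReal.ofReal (w x) ∂volume) *
      (⨍⁻ x in cube Q.corner Q.side, ENNReal.ofReal (w x ^ (-1 / (p - 1))) ∂volume) ^ (p - 1) ≤
      eApChar p w :=
  le_iSup_of_le Q.corner (le_iSup_of_le Q.side (le_iSup_of_le Q.side_pos le_rfl))

lemma setLAverage_dual_ne_top {p : ℝ} (hp : 1 < p) {w : (Fin d → ℝ) → ℝ} (hw : IsApWeight p w)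
    (Q : AxisCube d) :
    ⨍⁻ x in cube Q.corner Q.side, ENNReal.ofReal (w x ^ (-1 / (p - 1))) ∂volume ≠ ∞ := by
  intro h
  have h1 := mul_le_eApChar p w Q
  rw [h, ENNReal.top_rpow_of_pos (by linarith), ENNReal.mul_top (setLAverage_cube_ne_zero
    hw.isWeight.locallyIntegrable.aestronglyMeasurable.aemeasurable hw.isWeight.pos Q)] at h1
  exact absurd hw.finite (by simp [top_le_iff.1 h1])

/-- The dual weight is locally integrable. -/
lemma locallyIntegrable_dual {p : ℝ} (hp : 1 < p) {w : (Fin d → ℝ) → ℝ} (hw : IsApWeight p w) :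
    LocallyIntegrable (fun x => w x ^ (-1 / (p - 1))) volume := by
  rw [locallyIntegrable_iff]
  intro K hK
  obtain ⟨R, hR⟩ := hK.isBounded.subset_closedBall (0 : Fin d → ℝ)
  let Q : AxisCube d := ⟨fun _ => -(|R| + 1), 2 * (|R| + 1), by positivity⟩
  have hKQ : K ⊆ cube Q.corner Q.side := by
    intro x hx
    have h1 := hR hx
    rw [mem_closedBall_zero_iff] at h1
    have h2 : ∀ i, |x i| ≤ |R| := fun i => (norm_le_pi_norm x i).trans (h1.trans (le_abs_self R))
    refine ⟨fun i => ?_, fun i => ?_⟩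
    · have := abs_le.1 (h2 i)
      simp only [Q]
      linarith [this.1]
    · have := abs_le.1 (h2 i)
      simp only [Q]
      linarith [this.2]
  refine IntegrableOn.mono_set ?_ hKQ
  have hm : AEMeasurable (fun x => w x ^ (-1 / (p - 1))) volume :=
    hw.isWeight.locallyIntegrable.aestronglyMeasurable.aemeasurable.pow_const _
  refine ⟨hm.restrict.aestronglyMeasurable, ?_⟩
  rw [hasFiniteIntegral_iff_ofReal (ae_restrict_of_ae
    (hw.isWeight.pos.mono fun x hx => Real.rpow_nonneg hx.le _))]
  have h1 := setLAverage_dual_ne_top hp hw Q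
  rw [setLAverage_eq] at h1
  by_contra h2
  rw [not_lt, top_le_iff] at h2
  rw [h2, ENNReal.top_div_of_ne_top] at h1
  · exact h1 rfl
  · rw [volume_cube, ← volume_toSet]
    exact Q.volume_toSet_ne_top

lemma avg_mul_avg_dual_rpow_le {p : ℝ} (hp : 1 < p) {w : (Fin d → ℝ) → ℝ}
    (hw : IsApWeight p w) (Q : AxisCube d) :
    avg w Q * avg (fun x => w x ^ (-1 / (p - 1))) Q ^ (p - 1) ≤ apChar p w := by
  have hσ := locallyIntegrable_dual hp hw
  have hσ0 := hw.isWeight.pos.mono fun x hx => Real.rpow_pos_of_pos hx (-1 / (p - 1))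
  have hs := avg_pos hσ hσ0 Q
  have hv := avg_pos hw.isWeight.locallyIntegrable hw.isWeight.pos Q
  rw [apChar, ← ENNReal.ofReal_le_iff_le_toReal hw.finite.ne, ENNReal.ofReal_mul hv.le,
    ← ENNReal.ofReal_rpow_of_pos hs, ofReal_avg hw.isWeight.locallyIntegrable hw.isWeight.pos,
    ofReal_avg hσ hσ0]
  exact mul_le_eApChar p w Q

end AxisCube

/-! ### Self-improvement of the `A_β` condition. -/

open AxisCube

theorem theorem1p2 (d : ℕ) (hd : 1 ≤ d) (β : ℝ) (hβ : 1 < β)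
    (w : (Fin d → ℝ) → ℝ) (hw : IsApWeight β w) (r : ℝ)
    (hr : r =
      β * (1 + (2 : ℝ) ^ (β * (d : ℝ) / (β - 1)) * β ^ (β / (β - 1)) *
            apChar β w ^ (1 / (β - 1))) /
        (β + (2 : ℝ) ^ (β * (d : ℝ) / (β - 1)) * β ^ (β / (β - 1)) *
            apChar β w ^ (1 / (β - 1)))) :
    (1 < r ∧ r < β) ∧ IsApWeight r w ∧
      apChar r w ≤
        (2 : ℝ) ^ (r * (d : ℝ) + r) * apChar β w ^ ((r - 1) / (β - 1)) := by
  have hb : 0 < β - 1 := by linarith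
  set W := apChar β w with hW
  set α := 1 / (β - 1) with hα
  have hα0 : 0 < α := by positivity
  have hpα : β = 1 + 1 / α := by rw [hα]; field_simp; ring
  set σ : (Fin d → ℝ) → ℝ := fun x => w x ^ (-1 / (β - 1)) with hσdef
  have hwi := hw.isWeight.locallyIntegrable
  have hw0 := hw.isWeight.pos
  have hσ : LocallyIntegrable σ volume := locallyIntegrable_dual hβ hw
  have hσ0 : ∀ᵐ x ∂(volume : Measure (Fin d → ℝ)), 0 < σ x :=
    hw0.mono fun x hx => Real.rpow_pos_of_pos hx _
  have hchar : ∀ Q, avg w Q * avg σ Q ^ (β - 1) ≤ W := avg_mul_avg_dual_rpow_le hβ hw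
  have hone : ∀ Q, 1 ≤ avg σ Q * avg w Q ^ α :=
    one_le_avg_mul hα0 hσ hwi hw0 fun x => by rw [hσdef, hα, neg_div]
  set Q₀ : AxisCube d := ⟨0, 1, one_pos⟩
  have hW0 : 0 < W := (mul_pos (avg_pos hwi hw0 Q₀)
    (Real.rpow_pos_of_pos (avg_pos hσ hσ0 Q₀) _)).trans_le (hchar Q₀)
  -- Duality: the `A_β` condition for `w` raised to the power `α` is the condition on `σ` for the
  -- conjugate exponent `1 + α`.
  have hA : ∀ Q, avg σ Q * avg w Q ^ α ≤ W ^ α := by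
    intro Q
    have hs := avg_pos hσ hσ0 Q
    have hv := avg_pos hwi hw0 Q
    have h1 := Real.rpow_le_rpow (by positivity) (hchar Q) hα0.le
    rwa [Real.mul_rpow hv.le (by positivity), ← Real.rpow_mul hs.le,
      show (β - 1) * α = 1 by rw [hα]; field_simp, Real.rpow_one, mul_comm] at h1
  have hA1 : 1 ≤ W ^ α := (hone Q₀).trans (hA Q₀)
  set C := (2 : ℝ) ^ (β * (d : ℝ) / (β - 1)) * β ^ (β / (β - 1)) * W ^ α with hC
  have hC0 : 0 < C := by positivity
  set δ := β / C with hδ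
  have hδ0 : 0 < δ := by positivity
  have hr1 : (r - 1) * (1 + δ) = β - 1 := by
    rw [hr, hδ]; field_simp; ring
  have hr0 : 0 < r - 1 := by
    by_contra h
    nlinarith
  have hrβ : r < β := by nlinarith
  have hdual : ∀ x, 0 < w x → w x ^ (-1 / (r - 1)) = σ x ^ (1 + δ) := by
    intro x hx
    rw [hσdef, ← Real.rpow_mul hx.le]
    congr 1
    rw [← hr1]
    field_simp
  have hN2 : (2 : ℝ) ≤ 2 ^ d := by
    simpa using pow_le_pow_right₀ (show (1 : ℝ) ≤ 2 by norm_num) hd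
  -- The constant in `r` is large enough: `β ^ (β / (β - 1)) = β * β ^ α`, and `β * d / (β - 1) ≥
  -- d`.
  have hδA : δ * ((2 : ℝ) ^ d * (W ^ α * β ^ α)) ≤ 1 := by
    rw [hδ, div_mul_eq_mul_div, div_le_one hC0, hC]
    have e1 : β ^ (β / (β - 1)) = β * β ^ α := by
      rw [show β / (β - 1) = 1 + α by rw [hα]; field_simp; ring, Real.rpow_add (by linarith),
        Real.rpow_one]
    have e2 : (2 : ℝ) ^ d ≤ 2 ^ (β * (d : ℝ) / (β - 1)) := by
      rw [← Real.rpow_natCast]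
      refine Real.rpow_le_rpow_of_exponent_le (by norm_num) ?_
      rw [le_div_iff₀ hb]
      nlinarith [show (0 : ℝ) ≤ d by positivity]
    rw [e1]
    calc β * ((2 : ℝ) ^ d * (W ^ α * β ^ α)) = 2 ^ d * (β * β ^ α) * W ^ α := by ring
      _ ≤ _ := by gcongr
  have hδA2 : δ * (2 * W ^ α) ≤ 1 := by
    refine le_trans ?_ hδA
    have hβα : 1 ≤ β ^ α := Real.one_le_rpow hβ.le hα0.le
    have : 2 * W ^ α ≤ (2 : ℝ) ^ d * (W ^ α * β ^ α) := by
      have : W ^ α ≤ W ^ α * β ^ α := le_mul_of_one_le_right (by positivity) hβα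
      gcongr
    gcongr
  set κ := ((2 : ℝ) ^ d - 1) / ((2 : ℝ) ^ d - 1 - Real.log (2 ^ d)) with hκ
  have hκ0 : 0 ≤ κ := by
    refine div_nonneg (by linarith) ?_
    linarith [Real.log_le_sub_one_of_pos (by positivity : (0 : ℝ) < 2 ^ d)]
  have hκ4 : κ * (W ^ α) ^ δ ≤ 2 ^ ((d : ℝ) + 1) := by
    calc κ * (W ^ α) ^ δ ≤ (1 - Real.log 2)⁻¹ * (W ^ α) ^ δ := by
          gcongr; exact two_pow_sub_one_div_le hd
      _ ≤ 4 := inv_one_sub_log_two_mul_rpow_le hA1 hδ0.le hδA2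
      _ ≤ 2 ^ ((d : ℝ) + 1) := by
          rw [Real.rpow_add (by norm_num), Real.rpow_natCast, Real.rpow_one]
          linarith
  have hconst : κ ^ (r - 1) * W ≤ (2 : ℝ) ^ (r * (d : ℝ) + r) * W ^ ((r - 1) / (β - 1)) := by
    -- The exponents add up to `(r - 1) * (1 + δ) / (β - 1) = 1`; the second factor is the excess
    -- over the claimed power of `W`, and `hκ4` bounds it together with `κ`.
    have eW : W = W ^ ((r - 1) / (β - 1)) * ((W ^ α) ^ δ) ^ (r - 1) := by
      rw [← Real.rpow_mul hW0.le, ← Real.rpow_mul hW0.le, ← Real.rpow_add hW0,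
        show (r - 1) / (β - 1) + α * δ * (r - 1) = 1 by
          rw [hα]; field_simp; linarith, Real.rpow_one]
    calc κ ^ (r - 1) * W
        = (κ * (W ^ α) ^ δ) ^ (r - 1) * W ^ ((r - 1) / (β - 1)) := by
          rw [Real.mul_rpow hκ0 (by positivity)]
          conv_lhs => rw [eW]
          ring
      _ ≤ ((2 : ℝ) ^ ((d : ℝ) + 1)) ^ (r - 1) * W ^ ((r - 1) / (β - 1)) := by gcongr
      _ ≤ _ := by
          rw [← Real.rpow_mul (by norm_num)]
          gcongr
          · norm_num
          · nlinarith [show (0 : ℝ) ≤ d by positivity]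
  have hmain : eApChar r w ≤
      ENNReal.ofReal ((2 : ℝ) ^ (r * (d : ℝ) + r) * W ^ ((r - 1) / (β - 1))) := by
    refine iSup_le fun a => iSup_le fun l => iSup_le fun hl => ?_
    let Q : AxisCube d := ⟨a, l, hl⟩
    have hs := avg_pos hσ hσ0 Q
    have hv := avg_pos hwi hw0 Q
    have h1 : ⨍⁻ x in cube a l, ENNReal.ofReal (w x ^ (-1 / (r - 1))) ∂volume ≤
        ENNReal.ofReal (κ * avg σ Q ^ (1 + δ)) := by
      refine le_trans (le_of_eq ?_) (setLAverage_rpow_le hd hσ hσ0 hwi hw0 hα0 hpα hδ0.le hδA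
        hone hA Q)
      refine laverage_congr (ae_restrict_of_ae (hw0.mono fun x hx => ?_))
      simp only [hdual x hx]
    calc (⨍⁻ x in cube a l, ENNReal.ofReal (w x) ∂volume) *
          (⨍⁻ x in cube a l, ENNReal.ofReal (w x ^ (-1 / (r - 1))) ∂volume) ^ (r - 1)
        ≤ ENNReal.ofReal (avg w Q) * ENNReal.ofReal (κ * avg σ Q ^ (1 + δ)) ^ (r - 1) := by
          gcongr
          exact (ofReal_avg hwi hw0 Q).ge
      -- Since `(1 + δ) * (r - 1) = β - 1`, the `A_β` product reappears.
      _ = ENNReal.ofReal (κ ^ (r - 1) * (avg w Q * avg σ Q ^ (β - 1))) := by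
          rw [ENNReal.ofReal_rpow_of_nonneg (by positivity) hr0.le, ← ENNReal.ofReal_mul hv.le,
            Real.mul_rpow hκ0 (by positivity), ← Real.rpow_mul hs.le, mul_comm (1 + δ), hr1]
          congr 1
          ring
      _ ≤ _ := by
          refine ENNReal.ofReal_le_ofReal (le_trans ?_ hconst)
          gcongr
          exact hchar Q
  refine ⟨⟨by linarith, hrβ⟩, ⟨hw.isWeight, hmain.trans_lt ENNReal.ofReal_lt_top⟩, ?_⟩
  exact ENNReal.toReal_le_of_le_ofReal (by positivity) hmain
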